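/- Let $G=(V,E)$ be a finite non-empty simple undirected graph. A (graphical coalition) game $\mathcal G$ over $G$ is a function $v:2^V\to\mathbb N=\{0,1,2,\dots\}$ such that $v(S)=0$ whenever the induced subgraph $G[S]$ is not connected (the empty graph counts as not connected, so $v(\emptyset)=0$). Let $\kappa^f(\mathcal G)$ be the minimum of $\sum_{i\in V}x_i$ over all real vectors $x\ge 0$ with $\sum_{i\in S}x_i\ge v(S)$ for all $S\subseteq V$, and let $\kappa(\mathcal G)$ be the minimum over the integral vectors $x$ with these properties. A thicket of $G$ is a collection of pairwise intersecting vertex sets, each of which induces a connected subgraph of $G$; its hitting size is the minimum size of a vertex set meeting all its members; the thicket number $\tau(G)$ is the maximum hitting size of a thicket of $G$. (a) For every game $\mathcal G$ over $G$ that is not identically zero, $\kappa^f(\mathcal G)>0$ and $$\frac{\kappa(\mathcal G)}{\kappa^f(\mathcal G)}\le\tau(G).$$ (b) There is a game $\mathcal G$ over $G$, not identically zero, with $$\frac{\kappa(\mathcal G)}{\kappa^f(\mathcal G)}\ge\tfrac14\,\tau(G).$$ (c) More precisely, let $\mathcal H$ be any thicket of $G$ of hitting size $\tau(G)$ and let $X$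 be any hitting set of $\mathcal H$ with $|X|=\tau(G)$. Put $v(S)=1$ if $S$ is the union of a subfamily of $\mathcal H$ and $|S\cap X|\ge\frac12|X|$, and $v(S)=0$ for all other $S\subseteq V$. Then $v$ is a game over $G$, not identically zero, and it satisfies the inequality in (b). -/

import Mathlib

/-- A graphical coalition game over the interaction graph `G`: the agents are the vertices of `G`,
every coalition `S` has a value in `ℕ`, and a coalition which does not induce a connected subgraph
has value `0`. (`SimpleGraph.Connected` includes non-emptiness, so the empty coalition has
value `0`.) -/
structure CoalitionGame {V : Type*} (G : SimpleGraph V) where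
  /-- the valuation function -/
  val : Finset V → ℕ
  /-- only viable coalitions generate wealth -/
  viable : ∀ S : Finset V, ¬ (G.induce (S : Set V)).Connected → val S = 0

namespace CoalitionGame

variable {V : Type*} [Fintype V] {G : SimpleGraph V}

/-- Feasible solutions of the covering linear program. -/
def IsFractionalCover (g : CoalitionGame G) (x : V → ℝ) : Prop :=
  (∀ i, 0 ≤ x i) ∧ ∀ S : Finset V, (g.val S : ℝ) ≤ ∑ i ∈ S, x i

/-- Feasible integral solutions of the covering linear program. -/
def IsIntegralCover (g : CoalitionGame G) (x : V → ℕ) : Prop :=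
  ∀ S : Finset V, g.val S ≤ ∑ i ∈ S, x i

/-- `κᶠ`: the optimal value of the covering linear program. -/
noncomputable def fracCoverNumber (g : CoalitionGame G) : ℝ :=
  sInf {c : ℝ | ∃ x : V → ℝ, g.IsFractionalCover x ∧ ∑ i, x i = c}

/-- `κ`: the optimal value of the covering linear program over integral solutions. -/
noncomputable def coverNumber (g : CoalitionGame G) : ℕ :=
  sInf {c : ℕ | ∃ x : V → ℕ, g.IsIntegralCover x ∧ ∑ i, x i = c}

/-- The primal integrality gap `κ / κᶠ`. -/
noncomputable def primalGap (g : CoalitionGame G) : ℝ :=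
  (g.coverNumber : ℝ) / g.fracCoverNumber

/-- Integral covers exist, so that the minimum `κ` is attained. -/
theorem exists_isIntegralCover (g : CoalitionGame G) : ∃ x : V → ℕ, g.IsIntegralCover x := by
  refine ⟨fun _ => ∑ S : Finset V, g.val S, fun S => ?_⟩
  rcases S.eq_empty_or_nonempty with rfl | ⟨i, hi⟩
  · have h0 : g.val ∅ = 0 := by
      apply g.viable
      intro h
      obtain ⟨⟨v, hv⟩⟩ := h.nonempty
      simp at hv
    simp [h0]
  · calc g.val S ≤ ∑ S : Finset V, g.val S :=
          Finset.single_le_sum (f := g.val) (fun _ _ => Nat.zero_le _) (Finset.mem_univ S)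
      _ ≤ ∑ _j ∈ S, ∑ S : Finset V, g.val S :=
          Finset.single_le_sum (f := fun _ : V => ∑ S : Finset V, g.val S)
            (fun _ _ => Nat.zero_le _) hi

end CoalitionGame

section Thickets

variable {V : Type*}

/-- A thicket of `G`: a collection of vertex sets that induce connected subgraphs and intersect
pairwise. -/
def IsThicket (G : SimpleGraph V) (H : Finset (Finset V)) : Prop :=
  (∀ A ∈ H, (G.induce (A : Set V)).Connected) ∧
    ∀ A ∈ H, ∀ B ∈ H, ∃ v, v ∈ A ∧ v ∈ B

/-- `X` intersects every member of the collection `H`. -/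
def IsHittingSet (X : Finset V) (H : Finset (Finset V)) : Prop :=
  ∀ A ∈ H, ∃ v, v ∈ A ∧ v ∈ X

/-- The hitting size of a collection of (non-empty) vertex sets: the minimum size of a hitting
set. -/
noncomputable def hittingSize (H : Finset (Finset V)) : ℕ :=
  sInf {n : ℕ | ∃ X : Finset V, IsHittingSet X H ∧ X.card = n}

open Classical in
/-- The thicket number of `G`: the maximum hitting size of a thicket of `G`. -/
noncomputable def thicketNumber [Fintype V] (G : SimpleGraph V) : ℕ :=
  (Finset.univ.filter fun H : Finset (Finset V) => IsThicket G H).sup hittingSize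

open Classical in
/-- The valuation which gives value `1` to the unions of members of `H` that contain at least half
of the elements of `X`, and value `0` to all other coalitions. -/
noncomputable def halfHittingVal (H : Finset (Finset V)) (X : Finset V) (S : Finset V) : ℕ :=
  if (∃ H' ⊆ H, S = H'.biUnion id) ∧ X.card ≤ 2 * (S ∩ X).card then 1 else 0

end Thickets

/-! Upper bound: disjoint coalitions bound `κᶠ` from below, so an integral cover costing at most `τ`
times the value of a packing suffices. By `exists_mem_hitting_intersecting` some coalition `S₀` of
nonzero value and some `Z` with at most `τ` vertices are such that `Z` hits every coalition of
nonzero value that meets `S₀`. Put one unit on each vertex of `Z`, lower each value `v S` by `|S ∩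
Z|` and recurse: the cover pays at most `τ`, and the packing can gain at least 1.

`S₀` and `Z` come from a monotone search of `G` with at most `τ` guards: follow it to an innermost
territory that contains a member of the family. Such a search exists by a min-max argument in the
style of treewidth duality, with thickets as brambles (`IsThicket.exists_search`). It proceeds by
induction from large thickets down to the empty one, allowing also positions that fail to hit the
current thicket; the search for an enlarged thicket is re-rooted and projected into a component.

Lower bound: spreading weight 2 evenly over `X` gives `κᶠ ≤ 2`, while an integral cover of cost
below `|X| / 2` would produce a hitting set of the thicket smaller than `X`. -/

/-- A connected vertex set that meets `A` without being contained in `A` has an edge leaving `A`. -/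
theorem exists_adj_of_induce_connected {V : Type*} {G : SimpleGraph V} {b A : Set V}
    (hb : (G.induce b).Connected) {x y : V} (hx : x ∈ b) (hxA : x ∈ A) (hy : y ∈ b)
    (hyA : y ∉ A) : ∃ u ∈ b, u ∈ A ∧ ∃ w ∈ b, w ∉ A ∧ G.Adj u w := by
  obtain ⟨p⟩ := hb.preconnected ⟨x, hx⟩ ⟨y, hy⟩
  obtain ⟨d, -, h1, h2⟩ := p.exists_boundary_dart {v | (v : V) ∈ A} hxA hyA
  exact ⟨d.fst, d.fst.2, h1, d.snd, d.snd.2, h2, d.adj⟩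

/-- `C` is the vertex set of a connected component of `G - Z`. -/
structure IsComponent {V : Type*} (G : SimpleGraph V) (Z C : Finset V) : Prop where
  connected : (G.induce (C : Set V)).Connected
  notMem : ∀ u ∈ C, u ∉ Z
  closed : ∀ u ∈ C, ∀ w, G.Adj u w → w ∉ Z → w ∈ C

theorem IsComponent.subset {V : Type*} {G : SimpleGraph V} {Z C Q : Finset V}
    (hC : IsComponent G Z C) (hQ : (G.induce (Q : Set V)).Connected) (hQZ : ∀ u ∈ Q, u ∉ Z)
    {x : V} (hx : x ∈ Q) (hxC : x ∈ C) : Q ⊆ C := by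
  intro y hy
  by_contra hyC
  obtain ⟨u, -, huC, w, hw, hwC, huw⟩ := exists_adj_of_induce_connected (A := (C : Set V)) hQ
    (Finset.mem_coe.2 hx) (Finset.mem_coe.2 hxC) (Finset.mem_coe.2 hy) hyC
  exact hwC (hC.closed u huC w huw (hQZ w hw))

theorem exists_isComponent_superset {V : Type*} [Fintype V] {G : SimpleGraph V} {Z Q : Finset V}
    (hQ : (G.induce (Q : Set V)).Connected) (hQZ : ∀ u ∈ Q, u ∉ Z) :
    ∃ C, IsComponent G Z C ∧ Q ⊆ C := by
  classical
  obtain ⟨C, hQC, hC⟩ := Finite.exists_le_maximal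
    (p := fun D : Finset V => (G.induce (D : Set V)).Connected ∧ ∀ u ∈ D, u ∉ Z) ⟨hQ, hQZ⟩
  refine ⟨C, ⟨hC.prop.1, hC.prop.2, fun u hu w huw hw => ?_⟩, hQC⟩
  have h : (G.induce ((C ∪ {u, w} : Finset V) : Set V)).Connected := by
    have := G.induce_union_connected hC.prop.1.preconnected
      (G.induce_pair_connected_of_adj huw).preconnected ⟨u, hu, by simp⟩
    rwa [Finset.coe_union, Finset.coe_pair]
  refine hC.le_of_ge ⟨h, ?_⟩ Finset.subset_union_left (by simp)
  intro v hv
  simp only [Finset.mem_union, Finset.mem_insert, Finset.mem_singleton] at hv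
  rcases hv with hv | rfl | rfl
  exacts [hC.prop.2 v hv, hC.prop.2 v hu, hw]

theorem exists_isComponent_mem {V : Type*} [Fintype V] (G : SimpleGraph V) {Z : Finset V} {x : V}
    (hx : x ∉ Z) : ∃ C, IsComponent G Z C ∧ x ∈ C := by
  obtain ⟨C, hC, h⟩ := exists_isComponent_superset (G := G) (Z := Z) (Q := {x})
    (by rw [Finset.coe_singleton]; exact SimpleGraph.Connected.of_subsingleton) (by simpa using hx)
  exact ⟨C, hC, h (by simp)⟩

/-! ### Monotone searches: re-rooting and projection -/

/-- `Clearable G adm R`: a robber confined to the territory `R` is caught by a monotone search all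
of whose positions are admissible. A position `Z` splits the remaining territory into components
of `G - Z`, each of which has to be clearable. -/
inductive Clearable {V : Type*} (G : SimpleGraph V) (adm : Finset V → Prop) : Finset V → Prop
  | intro (R Z : Finset V) (hZ : adm Z) (hsub : ∀ z ∈ Z, z ∈ R ∨ ∃ u ∈ R, G.Adj u z)
      (hcomp : ∀ C, IsComponent G Z C → ∀ u ∈ C, u ∈ R → C ⊆ R)
      (hclear : ∀ C, IsComponent G Z C → C ⊆ R → Clearable G adm C) : Clearable G adm R

/-- Either the search of the component `R` of `G - Z₀` uses only positions satisfying `adm`, or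
the whole search can be started from one of its positions that violates `adm`. -/
theorem Clearable.clearable_or_exists_root {V : Type*} {G : SimpleGraph V}
    {adm adm' : Finset V → Prop} (hmono : ∀ Z Z', Z' ⊆ Z → adm' Z → adm' Z') {R : Finset V}
    (hR : Clearable G adm' R) : ∀ Z₀, adm' Z₀ → IsComponent G Z₀ R →
    (∀ C, IsComponent G Z₀ C → (∀ u ∈ C, u ∉ R) → Clearable G adm' C) →
    Clearable G adm R ∨
      ∃ Y, adm' Y ∧ ¬ adm Y ∧ ∀ C, IsComponent G Y C → Clearable G adm' C := by
  classical
  induction hR with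
  | intro R Z hZ hsub hcomp hclear ih =>
    intro Z₀ hZ₀ hR hother
    -- The search is turned around: outside `R`, step back from `Z` to the guards of `Z₀` lying in
    -- or next to `D`. The components then left inside `D` are components of `G - Z₀` disjoint from
    -- `R`.
    have hout : ∀ D, IsComponent G Z D → (∀ u ∈ D, u ∉ R) → Clearable G adm' D := by
      intro D hD hDR
      have key : ∀ z, z ∈ Z₀.filter (fun z => z ∈ D ∨ ∃ u ∈ D, G.Adj u z) ↔
          z ∈ Z₀ ∧ (z ∈ D ∨ ∃ u ∈ D, G.Adj u z) := fun z => Finset.mem_filter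
      refine Clearable.intro D (Z₀.filter fun z => z ∈ D ∨ ∃ u ∈ D, G.Adj u z)
        (hmono _ _ (Finset.filter_subset _ _) hZ₀) (fun z hz => ((key z).1 hz).2) ?_ ?_
      · intro C hC x hx hxD y hy
        by_contra hyD
        obtain ⟨u, hu, huD, w, hw, hwD, huw⟩ := exists_adj_of_induce_connected
          (A := (D : Set V)) hC.connected (Finset.mem_coe.2 hx) (Finset.mem_coe.2 hxD)
          (Finset.mem_coe.2 hy) hyD
        have hwZ₀ : w ∉ Z₀ := fun h => hC.notMem w hw ((key w).2 ⟨h, .inr ⟨u, huD, huw⟩⟩)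
        have huZ₀ : u ∉ Z₀ := fun h => hC.notMem u hu ((key u).2 ⟨h, .inl huD⟩)
        have hwZ : w ∈ Z := by
          by_contra h
          exact hwD (hD.closed u huD w huw h)
        have hwR : w ∈ R := by
          rcases hsub w hwZ with h | ⟨r, hr, hrw⟩
          · exact h
          · exact hR.closed r hr w hrw hwZ₀
        exact hDR u huD (hR.closed w hwR u huw.symm huZ₀)
      · intro C hC hCD
        refine hother C ⟨hC.connected, fun u hu h => ?_, fun u hu w huw hw => ?_⟩
          fun u hu => hDR u (hCD hu)
        · exact hC.notMem u hu ((key u).2 ⟨h, .inl (hCD hu)⟩)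
        · exact hC.closed u hu w huw fun h => hw ((key w).1 h).1
    have hall : ∀ D, IsComponent G Z D → Clearable G adm' D := by
      intro D hD
      by_cases h : ∃ u ∈ D, u ∈ R
      · obtain ⟨u, hu, huR⟩ := h
        exact hclear D hD (hcomp D hD u hu huR)
      · push Not at h
        exact hout D hD h
    by_cases hadm : adm Z
    · by_cases hcl : ∀ C, IsComponent G Z C → C ⊆ R → Clearable G adm C
      · exact .inl (.intro R Z hadm hsub hcomp hcl)
      · push Not at hcl
        obtain ⟨C, hC, hCR, hn⟩ := hcl
        rcases ih C hC hCR Z hZ hC fun D hD _ => hall D hD with h | h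
        · exact absurd h hn
        · exact .inr h
    · exact .inr ⟨Z, hZ, hadm, hall⟩

/-- Positions allowed in a search relative to the thicket `B`: the small ones and those that fail
to hit `B`. -/
def IsAdmissible {V : Type*} (k : ℕ) (B : Finset (Finset V)) (Z : Finset V) : Prop :=
  Z.card ≤ k ∨ ¬ IsHittingSet Z B

theorem IsAdmissible.mono {V : Type*} {k : ℕ} {B : Finset (Finset V)} {Z Z' : Finset V}
    (h : Z' ⊆ Z) (hZ : IsAdmissible k B Z) : IsAdmissible k B Z' :=
  hZ.imp (fun hc => (Finset.card_le_card h).trans hc) fun hn hh =>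
    hn fun A hA => (hh A hA).imp fun _ hv => ⟨hv.1, h hv.2⟩

/-- Let `X` be a minimum hitting set of the thicket `B`, let `Y` be another hitting set, and `C` a
component of `G - X` missing `Y`. A search of a territory `R` that misses `Y` projects to a search
of `R ∩ C` in which the vertices of `X` act as guards. -/
theorem Clearable.restrict_component {V : Type*} [Fintype V] {G : SimpleGraph V} {k : ℕ}
    {B : Finset (Finset V)} {X Y C R : Finset V} {adm' : Finset V → Prop} (hB : IsThicket G B)
    (hX : IsHittingSet X B) (hXmin : ∀ X', IsHittingSet X' B → X.card ≤ X'.card)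
    (hXk : X.card ≤ k) (hC : IsComponent G X C)
    (hadm' : ∀ Z, adm' Z → IsAdmissible k B Z ∨ ∀ v ∈ C, v ∉ Z)
    (hY : IsHittingSet Y B) (hYC : ∀ u ∈ C, u ∉ Y) (hR : Clearable G adm' R) :
    ∀ Q, (∀ u ∈ R, u ∉ Y) → Q ⊆ R → Q ⊆ C →
      (∀ u ∈ Q, ∀ w, G.Adj u w → w ∈ R → w ∈ C → w ∈ Q) →
      Clearable G (IsAdmissible k B) Q := by
  classical
  induction hR with
  | intro R Z hZ hsub hcomp hclear ih =>
    intro Q hRY hQR hQC hQ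
    have hbd : ∀ u ∈ R, u ∉ Z → ∀ w, G.Adj u w → w ∉ R → w ∈ Z := by
      intro u hu huZ w huw hw
      by_contra hwZ
      obtain ⟨D, hD, huD⟩ := exists_isComponent_mem G huZ
      exact hw (hcomp D hD u huD hu (hD.closed u huD w huw hwZ))
    have hxC : ∀ x ∈ X, x ∉ C := fun x hx h => hC.notMem x h hx
    -- Guards outside `C` are traded for the vertices of `X` in `R ∪ Z`. The complementary exchange,
    -- `X` outside `R ∪ Z` together with `Z` outside `C`, still hits `B`, so minimality of `X` gives
    -- `|Z'| ≤ |Z|`.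
    set Z' := Z.filter (· ∈ C) ∪ X.filter (fun x => x ∈ R ∨ x ∈ Z) with hZ'
    have memZ' : ∀ z, z ∈ Z' ↔ (z ∈ Z ∧ z ∈ C) ∨ (z ∈ X ∧ (z ∈ R ∨ z ∈ Z)) := by
      intro z
      simp only [hZ', Finset.mem_union, Finset.mem_filter]
    have hhit : IsHittingSet (X.filter (fun x => ¬ (x ∈ R ∨ x ∈ Z)) ∪ Z.filter (· ∉ C)) B := by
      intro b hb
      by_contra hcon
      simp only [Finset.mem_union, Finset.mem_filter, not_exists, not_and, not_or] at hcon
      obtain ⟨x, hxb, hxX⟩ := hX b hb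
      obtain ⟨y, hyb, hyY⟩ := hY b hb
      have hxR : x ∈ R := by
        have := hcon x hxb
        have := hxC x hxX
        tauto
      -- An unhit `b` would run from `R` to a vertex of `Y` outside `R ∪ C`. Its edge leaving `R ∪
      -- C` ends in `X` or in `Z`, hence in the exchanged set.
      obtain ⟨u, hub, huA, w, hwb, hwA, huw⟩ := exists_adj_of_induce_connected
        (A := {v | v ∈ R ∨ v ∈ C}) (hB.1 b hb) (Finset.mem_coe.2 hxb) (Or.inl hxR)
        (Finset.mem_coe.2 hyb) (fun h => h.elim (fun h => hRY y h hyY) fun h => hYC y h hyY)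
      have hw1 : w ∉ R := fun h => hwA (.inl h)
      have hw2 : w ∉ C := fun h => hwA (.inr h)
      have hwc := hcon w hwb
      by_cases huC : u ∈ C
      · have hwX : w ∈ X := by
          by_contra h
          exact hw2 (hC.closed u huC w huw h)
        tauto
      · have huR : u ∈ R := huA.resolve_right huC
        have huZ : u ∉ Z := by
          have := hcon u hub
          tauto
        have := hbd u huR huZ w huw hw1
        tauto
    have hcard : Z'.card ≤ Z.card := by
      have h1 := (hXmin _ hhit).trans (Finset.card_union_le _ _)
      have h2 := Finset.card_union_le (Z.filter (· ∈ C)) (X.filter (fun x => x ∈ R ∨ x ∈ Z))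
      have h3 := Finset.card_filter_add_card_filter_not (s := X) (fun x => x ∈ R ∨ x ∈ Z)
      have h4 := Finset.card_filter_add_card_filter_not (s := Z) (· ∈ C)
      rw [← hZ'] at h2
      omega
    have hadm : IsAdmissible k B Z' := by
      rcases hadm' Z hZ with (h | h) | h
      · exact .inl (hcard.trans h)
      · right
        intro hh
        apply h
        intro b hb
        by_contra hbZ
        push Not at hbZ
        obtain ⟨x, hxb, hx⟩ := hh b hb
        rw [memZ'] at hx
        have hxZ := hbZ x hxb
        have hxR : x ∈ R := by tauto
        -- A member `b` avoiding `Z` but meeting `R` is trapped in `R`, yet `Y` hits `b` and misses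
        -- `R`.
        obtain ⟨D, hD, hbD⟩ := exists_isComponent_superset (hB.1 b hb) hbZ
        obtain ⟨y, hyb, hyY⟩ := hY b hb
        exact hRY y (hcomp D hD x (hbD hxb) hxR (hbD hyb)) hyY
      · left
        refine (Finset.card_le_card fun z hz => ?_).trans hXk
        rw [memZ'] at hz
        have := h z
        tauto
    have key : ∀ z, z ∈ Z'.filter (fun z => z ∈ Q ∨ ∃ u ∈ Q, G.Adj u z) ↔
        z ∈ Z' ∧ (z ∈ Q ∨ ∃ u ∈ Q, G.Adj u z) := fun z => Finset.mem_filter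
    refine Clearable.intro Q (Z'.filter fun z => z ∈ Q ∨ ∃ u ∈ Q, G.Adj u z)
      (hadm.mono (Finset.filter_subset _ _)) (fun z hz => ((key z).1 hz).2) ?_ ?_
    · intro D hD x hx hxQ y hy
      by_contra hyQ
      obtain ⟨u, hu, huQ, w, hw, hwQ, huw⟩ := exists_adj_of_induce_connected
        (A := (Q : Set V)) hD.connected (Finset.mem_coe.2 hx) (Finset.mem_coe.2 hxQ)
        (Finset.mem_coe.2 hy) hyQ
      have hwZ' : w ∉ Z' := fun h => hD.notMem w hw ((key w).2 ⟨h, .inr ⟨u, huQ, huw⟩⟩)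
      have huZ' : u ∉ Z' := fun h => hD.notMem u hu ((key u).2 ⟨h, .inl huQ⟩)
      rw [memZ'] at hwZ' huZ'
      have huC := hQC huQ
      have huR := hQR huQ
      have hwRZ : w ∈ R ∨ w ∈ Z := by
        by_contra h
        rw [not_or] at h
        exact h.2 (hbd u huR (fun huZ => huZ' (.inl ⟨huZ, huC⟩)) w huw h.1)
      have hwC : w ∈ C := by
        by_contra h
        exact h (hC.closed u huC w huw fun hwX => hwZ' (.inr ⟨hwX, hwRZ⟩))
      rcases hwRZ with hwR | hwZ
      · exact hwQ (hQ u huQ w huw hwR hwC)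
      · exact hwZ' (.inl ⟨hwZ, hwC⟩)
    · intro D hD hDQ
      have hDZ : ∀ u ∈ D, u ∉ Z := fun u hu h =>
        hD.notMem u hu ((key u).2 ⟨(memZ' u).2 (.inl ⟨h, hQC (hDQ hu)⟩), .inl (hDQ hu)⟩)
      obtain ⟨E, hE, hDE⟩ := exists_isComponent_superset hD.connected hDZ
      obtain ⟨⟨d, hd⟩⟩ := hD.connected.nonempty
      have hER : E ⊆ R := hcomp E hE d (hDE hd) (hQR (hDQ hd))
      refine ih E hE hER D (fun u hu => hRY u (hER hu)) hDE (hDQ.trans hQC) ?_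
      intro u hu w huw hwE hwC
      refine hD.closed u hu w huw fun hw => ?_
      have h1 := (memZ' w).1 ((key w).1 hw).1
      have h2 := hE.notMem w hwE
      have h3 := hxC w
      tauto

/-! ### Duality between thickets and searches -/

theorem hittingSize_le_card {V : Type*} {X : Finset V} {B : Finset (Finset V)}
    (h : IsHittingSet X B) : hittingSize B ≤ X.card :=
  Nat.sInf_le ⟨X, h, rfl⟩

theorem IsThicket.exists_isHittingSet_card {V : Type*} [Fintype V] {G : SimpleGraph V}
    {B : Finset (Finset V)} (hB : IsThicket G B) :
    ∃ X, IsHittingSet X B ∧ X.card = hittingSize B := by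
  have hne : {n : ℕ | ∃ X : Finset V, IsHittingSet X B ∧ X.card = n}.Nonempty := by
    refine ⟨_, Finset.univ, fun A hA => ?_, rfl⟩
    obtain ⟨⟨v, hv⟩⟩ := (hB.1 A hA).nonempty
    exact ⟨v, hv, Finset.mem_univ v⟩
  exact Nat.sInf_mem hne

theorem IsThicket.hittingSize_le_thicketNumber {V : Type*} [Fintype V] {G : SimpleGraph V}
    {B : Finset (Finset V)} (hB : IsThicket G B) : hittingSize B ≤ thicketNumber G := by
  classical
  unfold thicketNumber
  exact Finset.le_sup (f := hittingSize) (by simpa using hB)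

/-- Every thicket `B` admits a search of the whole graph by positions which are small or fail to
hit `B`. -/
theorem IsThicket.exists_search {V : Type*} [Fintype V] {G : SimpleGraph V} {k : ℕ}
    (hk : thicketNumber G ≤ k) {B : Finset (Finset V)} (hB : IsThicket G B) :
    ∃ Z, IsAdmissible k B Z ∧ ∀ C, IsComponent G Z C → Clearable G (IsAdmissible k B) C := by
  classical
  induction B using WellFoundedGT.induction with
  | ind B ih =>
    by_contra hcon
    push Not at hcon
    obtain ⟨X, hX, hXc⟩ := hB.exists_isHittingSet_card
    have hXk : X.card ≤ k := hXc ▸ hB.hittingSize_le_thicketNumber.trans hk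
    obtain ⟨C, hC, hCn⟩ := hcon X (.inl hXk)
    apply hCn
    by_cases hmeet : ∃ b ∈ B, ∀ v ∈ b, v ∉ C
    · obtain ⟨b, hb, hbC⟩ := hmeet
      -- Occupying all of `C` is admissible, because `b` avoids `C`.
      refine .intro C C (.inr fun h => ?_) (fun z hz => .inl hz)
        (fun D hD u hu huC => absurd huC (hD.notMem u hu)) (fun D hD hDC => ?_)
      · obtain ⟨v, hv, hvC⟩ := h b hb
        exact hbC v hv hvC
      · obtain ⟨⟨d, hd⟩⟩ := hD.connected.nonempty
        exact absurd (hDC hd) (hD.notMem d hd)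
    · push Not at hmeet
      have hCB : C ∉ B := fun h => by
        obtain ⟨v, hv, hvX⟩ := hX C h
        exact hC.notMem v hv hvX
      have hB' : IsThicket G (insert C B) := by
        refine ⟨fun A hA => ?_, fun A hA A' hA' => ?_⟩
        · rcases Finset.mem_insert.1 hA with rfl | hA
          exacts [hC.connected, hB.1 A hA]
        · rcases Finset.mem_insert.1 hA with rfl | hAB <;>
            rcases Finset.mem_insert.1 hA' with rfl | hAB'
          · obtain ⟨⟨c, hc⟩⟩ := hC.connected.nonempty
            exact ⟨c, hc, hc⟩
          · obtain ⟨v, h1, h2⟩ := hmeet A' hAB'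
            exact ⟨v, h2, h1⟩
          · exact hmeet A hAB
          · exact hB.2 A hAB A' hAB'
      have hadm' : ∀ Z, IsAdmissible k (insert C B) Z → IsAdmissible k B Z ∨ ∀ v ∈ C, v ∉ Z := by
        rintro Z (h | h)
        · exact .inl (.inl h)
        · by_cases hZC : ∀ v ∈ C, v ∉ Z
          · exact .inr hZC
          · push Not at hZC
            refine .inl (.inr fun hh => h fun A hA => ?_)
            rcases Finset.mem_insert.1 hA with rfl | hA
            exacts [hZC, hh A hA]
      -- As `B` itself has no search, the one for `insert C B` can be rooted at a position
      -- inadmissible for `B`; this position hits `B` and misses `C`.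
      obtain ⟨Y, hY', hYB, hYcl⟩ : ∃ Y, IsAdmissible k (insert C B) Y ∧ ¬ IsAdmissible k B Y ∧
          ∀ D, IsComponent G Y D → Clearable G (IsAdmissible k (insert C B)) D := by
        obtain ⟨Z₀, hZ₀, hcl⟩ := ih (insert C B) (Finset.ssubset_insert hCB) hB'
        by_cases h0 : IsAdmissible k B Z₀
        · obtain ⟨D, hD, hDn⟩ := hcon Z₀ h0
          exact ((hcl D hD).clearable_or_exists_root (fun _ _ h h' => h'.mono h) Z₀ hZ₀ hD
            fun E hE _ => hcl E hE).resolve_left hDn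
        · exact ⟨Z₀, hZ₀, h0, hcl⟩
      have hYC := (hadm' Y hY').resolve_left hYB
      have hYhit : IsHittingSet Y B := by
        by_contra h
        exact hYB (.inr h)
      obtain ⟨D, hD, hCD⟩ := exists_isComponent_superset hC.connected hYC
      exact (hYcl D hD).restrict_component hB hX
        (fun X' hX' => hXc ▸ hittingSize_le_card hX') hXk hC hadm' hYhit hYC C hD.notMem hCD
        subset_rfl fun _ _ _ _ _ h => h

/-! ### Covers against packings: the upper bound -/

/-- In a nonempty family of connected sets some member `S` has the property that the members
intersecting `S` are hit by at most `thicketNumber G` vertices. -/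
theorem exists_mem_hitting_intersecting {V : Type*} [Fintype V] (G : SimpleGraph V)
    (W : Finset V → Prop) (hW : ∀ S, W S → (G.induce (S : Set V)).Connected)
    (hne : ∃ S, W S) : ∃ S, W S ∧ ∃ Z : Finset V, Z.card ≤ thicketNumber G ∧
      ∀ S', W S' → (∃ v ∈ S, v ∈ S') → ∃ v ∈ S', v ∈ Z := by
  classical
  have hcl : ∀ R, Clearable G (IsAdmissible (thicketNumber G) ∅) R → (∃ S, W S ∧ S ⊆ R) →
      ∃ S, W S ∧ ∃ Z : Finset V, Z.card ≤ thicketNumber G ∧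
      ∀ S', W S' → (∃ v ∈ S, v ∈ S') → ∃ v ∈ S', v ∈ Z := by
    intro R hR
    induction hR with
    | intro R Z hZ hsub hcomp hclear ih =>
      rintro ⟨S, hS, hSR⟩
      by_cases hin : ∃ C, IsComponent G Z C ∧ C ⊆ R ∧ ∃ S, W S ∧ S ⊆ C
      · obtain ⟨C, hC, hCR, h⟩ := hin
        exact ih C hC hCR h
      -- The territory is innermost: a member meeting `S` and avoiding `Z` would lie in a smaller
      -- piece of it. Every set hits the empty thicket, so admissible means small.
      · refine ⟨S, hS, Z, hZ.resolve_right (fun h => h fun A hA => by simp at hA), ?_⟩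
        rintro S' hS' ⟨v, hvS, hvS'⟩
        by_contra hn
        push Not at hn
        obtain ⟨C, hC, hSC⟩ := exists_isComponent_superset (hW S' hS') hn
        exact hin ⟨C, hC, hcomp C hC v (hSC hvS') (hSR hvS), S', hS', hSC⟩
  obtain ⟨Z, hZ, hZcl⟩ := IsThicket.exists_search (G := G) le_rfl (B := ∅)
    ⟨by simp, by simp⟩
  by_cases hin : ∃ C, IsComponent G Z C ∧ ∃ S, W S ∧ S ⊆ C
  · obtain ⟨C, hC, h⟩ := hin
    exact hcl C (hZcl C hC) h
  · obtain ⟨S, hS⟩ := hne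
    refine ⟨S, hS, Z, hZ.resolve_right (fun h => h fun A hA => by simp at hA), ?_⟩
    intro S' hS' _
    by_contra hn
    push Not at hn
    obtain ⟨C, hC, hSC⟩ := exists_isComponent_superset (hW S' hS') hn
    exact hin ⟨C, hC, S', hS', hSC⟩

/-- An integral cover and a packing of disjoint coalitions whose values differ by a factor of at
most the thicket number. -/
theorem exists_cover_le_thicketNumber_mul_packing {V : Type*} [Fintype V] {G : SimpleGraph V}
    (v : Finset V → ℕ) (hv : ∀ S, v S ≠ 0 → (G.induce (S : Set V)).Connected) :
    ∃ (x : V → ℕ) (P : Finset (Finset V)), (∀ S, v S ≤ ∑ i ∈ S, x i) ∧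
      (P : Set (Finset V)).PairwiseDisjoint id ∧
      ∑ i, x i ≤ thicketNumber G * ∑ S ∈ P, v S := by
  classical
  induction hn : ∑ S, v S using Nat.strong_induction_on generalizing v with
  | _ n ih =>
    by_cases hne : ∃ S, v S ≠ 0
    · obtain ⟨S₀, hS₀, Z, hZ, hhit⟩ := exists_mem_hitting_intersecting G (v · ≠ 0) hv hne
      have hcard : ∀ S, v S ≠ 0 → (∃ i ∈ S₀, i ∈ S) → 1 ≤ (S ∩ Z).card := by
        intro S hS hSS
        obtain ⟨i, hi, hiZ⟩ := hhit S hS hSS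
        exact Finset.card_pos.2 ⟨i, Finset.mem_inter.2 ⟨hi, hiZ⟩⟩
      obtain ⟨⟨i₀, hi₀⟩⟩ := (hv S₀ hS₀).nonempty
      have hlt : ∑ S, (v S - (S ∩ Z).card) < n := by
        rw [← hn]
        refine Finset.sum_lt_sum (fun S _ => Nat.sub_le _ _) ⟨S₀, Finset.mem_univ _, ?_⟩
        have := hcard S₀ hS₀ ⟨i₀, hi₀, hi₀⟩
        omega
      obtain ⟨x, P, hx, hP, hxP⟩ := ih _ hlt (fun S => v S - (S ∩ Z).card)
        (fun S hS => hv S fun h => hS (by simp [h])) rfl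
      refine ⟨fun i => x i + if i ∈ Z then 1 else 0, ?_⟩
      have hcov : ∀ S, v S ≤ ∑ i ∈ S, (x i + if i ∈ Z then 1 else 0) := by
        intro S
        have h1 := hx S
        rw [Finset.sum_add_distrib, Finset.sum_boole, Finset.filter_mem_eq_inter, Nat.cast_id]
        omega
      have hsum : ∑ i, (x i + if i ∈ Z then 1 else 0) ≤
          thicketNumber G * (∑ S ∈ P, (v S - (S ∩ Z).card) + 1) := by
        rw [Finset.sum_add_distrib, Finset.sum_boole, Finset.filter_mem_eq_inter,
          Finset.univ_inter, Nat.cast_id, mul_add, mul_one]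
        exact add_le_add hxP hZ
      suffices h : ∃ P' : Finset (Finset V), (P' : Set (Finset V)).PairwiseDisjoint id ∧
          ∑ S ∈ P, (v S - (S ∩ Z).card) + 1 ≤ ∑ S ∈ P', v S by
        obtain ⟨P', h1, h2⟩ := h
        exact ⟨P', hcov, h1, hsum.trans (Nat.mul_le_mul_left _ h2)⟩
      -- Either a packed coalition meets `S₀`, hence `Z`, and regains a lost unit, or `S₀` can join
      -- the packing once the members of value 0 are discarded.
      by_cases hmeet : ∃ S ∈ P, v S ≠ 0 ∧ ∃ i ∈ S₀, i ∈ S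
      · obtain ⟨S, hS, hvS, hSS⟩ := hmeet
        refine ⟨P, hP, Finset.sum_lt_sum (fun S _ => Nat.sub_le _ _) ⟨S, hS, ?_⟩⟩
        have := hcard S hvS hSS
        omega
      · push Not at hmeet
        have hS₀P : S₀ ∉ P.filter (v · ≠ 0) := fun h =>
          hmeet S₀ (Finset.mem_filter.1 h).1 hS₀ i₀ hi₀ hi₀
        refine ⟨insert S₀ (P.filter (v · ≠ 0)), ?_, ?_⟩
        · rw [Finset.coe_insert]
          refine (hP.subset (Finset.filter_subset _ _)).insert fun S hS _ => ?_
          have hS' := Finset.mem_filter.1 (Finset.mem_coe.1 hS)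
          exact Finset.disjoint_left.2 fun i hi hiS => hmeet S hS'.1 hS'.2 i hi hiS
        · rw [Finset.sum_insert hS₀P, Finset.sum_filter_ne_zero, add_comm]
          exact add_le_add (Nat.one_le_iff_ne_zero.2 hS₀)
            (Finset.sum_le_sum fun S _ => Nat.sub_le _ _)
    · push Not at hne
      exact ⟨0, ∅, fun S => by simp [hne S], by simp, by simp⟩

namespace CoalitionGame

variable {V : Type*} [Fintype V] {G : SimpleGraph V}

theorem coverNumber_le {g : CoalitionGame G} {x : V → ℕ} (hx : g.IsIntegralCover x) :
    g.coverNumber ≤ ∑ i, x i :=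
  Nat.sInf_le ⟨x, hx, rfl⟩

theorem exists_isIntegralCover_sum_eq (g : CoalitionGame G) :
    ∃ x : V → ℕ, g.IsIntegralCover x ∧ ∑ i, x i = g.coverNumber := by
  obtain ⟨x, hx⟩ := g.exists_isIntegralCover
  exact Nat.sInf_mem (s := {c : ℕ | ∃ x : V → ℕ, g.IsIntegralCover x ∧ ∑ i, x i = c})
    ⟨_, x, hx, rfl⟩

theorem fracCoverNumber_le {g : CoalitionGame G} {x : V → ℝ} (hx : g.IsFractionalCover x) :
    g.fracCoverNumber ≤ ∑ i, x i := by
  refine csInf_le ⟨0, ?_⟩ ⟨x, hx, rfl⟩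
  rintro _ ⟨y, hy, rfl⟩
  exact Finset.sum_nonneg fun i _ => hy.1 i

/-- Disjoint coalitions bound the fractional cover number from below. -/
theorem sum_packing_le_fracCoverNumber (g : CoalitionGame G) {P : Finset (Finset V)}
    (hP : (P : Set (Finset V)).PairwiseDisjoint id) :
    ((∑ S ∈ P, g.val S : ℕ) : ℝ) ≤ g.fracCoverNumber := by
  classical
  refine le_csInf ?_ ?_
  · obtain ⟨x, hx⟩ := g.exists_isIntegralCover
    refine ⟨_, fun i => (x i : ℝ), ⟨fun i => Nat.cast_nonneg _, fun S => ?_⟩, rfl⟩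
    dsimp only
    exact_mod_cast hx S
  · rintro _ ⟨x, hx, rfl⟩
    push_cast
    calc ∑ S ∈ P, (g.val S : ℝ) ≤ ∑ S ∈ P, ∑ i ∈ S, x i := Finset.sum_le_sum fun S _ => hx.2 S
      _ = ∑ i ∈ P.biUnion id, x i := (Finset.sum_biUnion hP).symm
      _ ≤ ∑ i, x i := Finset.sum_le_sum_of_subset_of_nonneg (Finset.subset_univ _)
          fun i _ _ => hx.1 i

theorem fracCoverNumber_pos {g : CoalitionGame G} (hg : g.val ≠ 0) : 0 < g.fracCoverNumber := by
  obtain ⟨S, hS⟩ := Function.ne_iff.1 hg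
  refine lt_of_lt_of_le ?_ (g.sum_packing_le_fracCoverNumber (P := {S}) (by simp))
  simpa using Nat.pos_of_ne_zero hS

theorem primalGap_le_thicketNumber {g : CoalitionGame G} (hg : g.val ≠ 0) :
    g.primalGap ≤ (thicketNumber G : ℝ) := by
  obtain ⟨x, P, hx, hP, hxP⟩ := exists_cover_le_thicketNumber_mul_packing (G := G) g.val
    fun S hS => not_imp_comm.1 (g.viable S) hS
  rw [primalGap, div_le_iff₀ (fracCoverNumber_pos hg)]
  calc (g.coverNumber : ℝ) ≤ ((thicketNumber G * ∑ S ∈ P, g.val S : ℕ) : ℝ) :=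
        mod_cast (coverNumber_le hx).trans hxP
    _ ≤ thicketNumber G * g.fracCoverNumber := by
        rw [Nat.cast_mul]
        exact mul_le_mul_of_nonneg_left (g.sum_packing_le_fracCoverNumber hP) (Nat.cast_nonneg _)

end CoalitionGame

/-! ### The half-hitting game: the lower bound -/

theorem halfHittingVal_eq_one {V : Type*} {H : Finset (Finset V)} {X S : Finset V}
    (h : halfHittingVal H X S ≠ 0) : halfHittingVal H X S = 1 := by
  unfold halfHittingVal at *
  split_ifs at * <;> simp_all

open Classical in
theorem halfHittingVal_ne_zero_iff {V : Type*} {H : Finset (Finset V)} {X S : Finset V} :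
    halfHittingVal H X S ≠ 0 ↔
      (∃ H' ⊆ H, S = H'.biUnion id) ∧ X.card ≤ 2 * (S ∩ X).card := by
  unfold halfHittingVal
  split_ifs with h <;> simp [h]

theorem IsThicket.connected_of_halfHittingVal_ne_zero {V : Type*} {G : SimpleGraph V}
    {H : Finset (Finset V)} {X S : Finset V}
    (hH : IsThicket G H) (hX : X.Nonempty) (hS : halfHittingVal H X S ≠ 0) :
    (G.induce (S : Set V)).Connected := by
  classical
  obtain ⟨⟨H', hH', rfl⟩, hc⟩ := halfHittingVal_ne_zero_iff.1 hS
  have hne : H'.Nonempty := by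
    rw [Finset.nonempty_iff_ne_empty]
    rintro rfl
    rw [Finset.biUnion_empty, Finset.empty_inter, Finset.card_empty] at hc
    have := hX.card_pos
    omega
  have h := G.induce_sUnion_connected_of_pairwise_not_disjoint
    (S := (fun A : Finset V => (A : Set V)) '' H') (by simpa using hne) ?_ ?_
  · have hU : ((H'.biUnion id : Finset V) : Set V) =
        ⋃₀ ((fun A : Finset V => (A : Set V)) '' H') := by
      ext v
      simp
    rwa [hU]
  · rintro _ _ ⟨A, hA, rfl⟩ ⟨B, hB, rfl⟩
    obtain ⟨v, h1, h2⟩ := hH.2 A (hH' hA) B (hH' hB)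
    exact ⟨v, h1, h2⟩
  · rintro _ ⟨A, hA, rfl⟩
    exact hH.1 A (hH' hA)

section LowerBound

variable {V : Type*} [Fintype V] {G : SimpleGraph V}

theorem thicketNumber_pos [Nonempty V] (G : SimpleGraph V) : 0 < thicketNumber G := by
  obtain ⟨v⟩ := ‹Nonempty V›
  have hT : IsThicket G {{v}} := by
    refine ⟨fun A hA => ?_, fun A hA B hB => ?_⟩
    · rw [Finset.mem_singleton.1 hA, Finset.coe_singleton]
      exact SimpleGraph.Connected.of_subsingleton
    · rw [Finset.mem_singleton.1 hA, Finset.mem_singleton.1 hB]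
      exact ⟨v, by simp⟩
  refine lt_of_lt_of_le ?_ hT.hittingSize_le_thicketNumber
  obtain ⟨X, hX, hXc⟩ := hT.exists_isHittingSet_card
  obtain ⟨w, -, hw⟩ := hX {v} (by simp)
  exact hXc ▸ Finset.card_pos.2 ⟨w, hw⟩

theorem exists_isThicket_hittingSize_eq (G : SimpleGraph V) :
    ∃ H, IsThicket G H ∧ hittingSize H = thicketNumber G := by
  classical
  obtain ⟨H, hH, h⟩ := Finset.exists_mem_eq_sup
    (Finset.univ.filter fun H : Finset (Finset V) => IsThicket G H)
    ⟨∅, Finset.mem_filter.2 ⟨Finset.mem_univ _, by simp, by simp⟩⟩ hittingSize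
  refine ⟨H, by simpa using hH, ?_⟩
  rw [← h, thicketNumber]

theorem exists_halfHittingGame [Nonempty V] {H : Finset (Finset V)} {X : Finset V}
    (hH : IsThicket G H) (hHτ : hittingSize H = thicketNumber G) (hX : IsHittingSet X H)
    (hXc : X.card = hittingSize H) :
    ∃ g : CoalitionGame G, g.val = halfHittingVal H X ∧ g.val ≠ 0 ∧
      (1 / 4 : ℝ) * (thicketNumber G : ℝ) ≤ g.primalGap := by
  classical
  have hXpos : 0 < X.card := by
    rw [hXc, hHτ]
    exact thicketNumber_pos G
  let g : CoalitionGame G := ⟨halfHittingVal H X, fun S hS => by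
    by_contra h
    exact hS (hH.connected_of_halfHittingVal_ne_zero (Finset.card_pos.1 hXpos) h)⟩
  have hXH : X ⊆ H.biUnion id := by
    have hhit : IsHittingSet (X ∩ H.biUnion id) H := fun A hA => by
      obtain ⟨v, hv, hvX⟩ := hX A hA
      exact ⟨v, hv, Finset.mem_inter.2 ⟨hvX, Finset.mem_biUnion.2 ⟨A, hA, hv⟩⟩⟩
    exact Finset.inter_eq_left.1 (Finset.eq_of_subset_of_card_le Finset.inter_subset_left
      (hXc ▸ hittingSize_le_card hhit))
  have hg : g.val ≠ 0 := by
    intro h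
    refine halfHittingVal_ne_zero_iff.2 ⟨⟨H, subset_rfl, rfl⟩, ?_⟩ (congrFun h (H.biUnion id))
    rw [Finset.inter_eq_right.2 hXH]
    omega
  have hXR : (0 : ℝ) < X.card := by exact_mod_cast hXpos
  have hfrac : g.fracCoverNumber ≤ 2 := by
    refine (CoalitionGame.fracCoverNumber_le
      (x := fun i => if i ∈ X then 2 / (X.card : ℝ) else 0) ⟨fun i => ?_, fun S => ?_⟩).trans ?_
    · dsimp only
      split_ifs <;> positivity
    · rw [← Finset.sum_filter, Finset.filter_mem_eq_inter, Finset.sum_const, nsmul_eq_mul]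
      by_cases h : g.val S = 0
      · rw [h, Nat.cast_zero]
        positivity
      · rw [show g.val S = 1 from halfHittingVal_eq_one h, mul_div_assoc', le_div_iff₀ hXR]
        have := (halfHittingVal_ne_zero_iff.1 h).2
        have : (X.card : ℝ) ≤ 2 * (S ∩ X).card := by exact_mod_cast this
        push_cast
        linarith
    · rw [← Finset.sum_filter, Finset.filter_mem_eq_inter, Finset.univ_inter, Finset.sum_const,
        nsmul_eq_mul, mul_div_cancel₀ _ hXR.ne']
  have hint : X.card ≤ 2 * g.coverNumber := by
    obtain ⟨x, hx, hxs⟩ := g.exists_isIntegralCover_sum_eq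
    set Y := Finset.univ.filter fun i => x i ≠ 0 with hY
    have hYx : Y.card ≤ g.coverNumber := by
      rw [← hxs, Finset.card_eq_sum_ones]
      calc ∑ i ∈ Y, 1 ≤ ∑ i ∈ Y, x i := Finset.sum_le_sum fun i hi =>
            Nat.one_le_iff_ne_zero.2 (Finset.mem_filter.1 hi).2
        _ ≤ ∑ i, x i := Finset.sum_le_sum_of_subset (Finset.subset_univ _)
    set H' := H.filter fun A => ∀ v ∈ A, v ∉ Y
    -- The cover vanishes on this union of the members missing its support `Y`, so `S` has value 0
    -- and contains less than half of `X`. Since `Y ∪ (S ∩ X)` hits `H`, `Y` accounts for the other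
    -- half.
    set S := H'.biUnion id with hS
    have hzero : halfHittingVal H X S = 0 := by
      refine Nat.le_zero.1 ((hx S).trans (Finset.sum_eq_zero fun i hi => ?_).le)
      obtain ⟨A, hA, hiA⟩ := Finset.mem_biUnion.1 hi
      by_contra h
      exact (Finset.mem_filter.1 hA).2 i hiA (by simpa [hY] using h)
    have hsmall : 2 * (S ∩ X).card < X.card := by
      by_contra h
      exact halfHittingVal_ne_zero_iff.2
        ⟨⟨H', Finset.filter_subset _ _, rfl⟩, not_lt.1 h⟩ hzero
    have hhit : IsHittingSet (Y ∪ S ∩ X) H := by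
      intro A hA
      by_cases h : ∀ v ∈ A, v ∉ Y
      · obtain ⟨v, hv, hvX⟩ := hX A hA
        refine ⟨v, hv, Finset.mem_union_right _ (Finset.mem_inter.2 ⟨?_, hvX⟩)⟩
        exact Finset.mem_biUnion.2 ⟨A, Finset.mem_filter.2 ⟨hA, h⟩, hv⟩
      · push Not at h
        obtain ⟨v, hv, hvY⟩ := h
        exact ⟨v, hv, Finset.mem_union_left _ hvY⟩
    have h1 := (hittingSize_le_card hhit).trans (Finset.card_union_le _ _)
    rw [← hXc] at h1
    omega
  refine ⟨g, rfl, hg, ?_⟩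
  rw [CoalitionGame.primalGap, le_div_iff₀ (CoalitionGame.fracCoverNumber_pos hg), ← hHτ, ← hXc]
  have hint' : (X.card : ℝ) ≤ 2 * g.coverNumber := by exact_mod_cast hint
  have := mul_le_mul_of_nonneg_left hfrac hXR.le
  linarith

end LowerBound

theorem theorem2 {V : Type*} [Fintype V] [Nonempty V] (G : SimpleGraph V) :
    (∀ g : CoalitionGame G, g.val ≠ 0 →
      0 < g.fracCoverNumber ∧ g.primalGap ≤ (thicketNumber G : ℝ)) ∧
    (∃ g : CoalitionGame G, g.val ≠ 0 ∧ (1 / 4 : ℝ) * (thicketNumber G : ℝ) ≤ g.primalGap) ∧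
    (∀ (H : Finset (Finset V)) (X : Finset V),
      IsThicket G H → hittingSize H = thicketNumber G →
      IsHittingSet X H → X.card = hittingSize H →
      ∃ g : CoalitionGame G, g.val = halfHittingVal H X ∧ g.val ≠ 0 ∧
        (1 / 4 : ℝ) * (thicketNumber G : ℝ) ≤ g.primalGap) := by
  refine ⟨fun g hg => ⟨CoalitionGame.fracCoverNumber_pos hg,
    CoalitionGame.primalGap_le_thicketNumber hg⟩, ?_, fun H X hH hHτ hX hXc =>
    exists_halfHittingGame hH hHτ hX hXc⟩
  obtain ⟨H, hH, hHτ⟩ := exists_isThicket_hittingSize_eq G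
  obtain ⟨X, hX, hXc⟩ := hH.exists_isHittingSet_card
  obtain ⟨g, -, h⟩ := exists_halfHittingGame hH hHτ hX hXc
  exact ⟨g, h⟩
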